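/- All systems are finite-dimensional and non-zero. For a system $B$ let $\mathbf{u}^B=I^B/|B|$ be the uniform (maximally mixed) state; a channel is a completely positive trace-preserving map, and an isometry $V$ is identified with the channel $\mathcal{V}(\cdot)=V(\cdot)V^\dagger$. Definitions. A channel $\mathcal{E}^{RB\to B}$ is *conditionally unital* if for every state $\tau^R$ the map $\omega^B\mapsto\mathcal{E}(\tau^R\otimes\omega^B)$ is a doubly stochastic channel, i.e. a channel that fixes $\mathbf{u}^B$. A channel $\mathcal{N}^{A'B\to AB}$ is *conditionally unital* if for every state $\rho^{A'}$ there is a state $\sigma^A$ with $\mathcal{N}(\rho^{A'}\otimes\mathbf{u}^B)=\sigma^A\otimes\mathbf{u}^B$; it is *$B\not\to A$ signalling* if the reduced output state on $A$ depends only on the reduced input state on $A'$; it is *conditionally mixing* if it is both $B\not\to A$ signalling and conditionally unital. A *superchannel* from $A\to B$ to $A'\to B$ is a linear map $\Theta$ from linear maps $\mathcal F^{A\to B}$ of operators to linear maps of operators $A'\to B$ such that, for all systems $C,D$, $\Theta\otimes\mathbb{1}^{(C\to D)}$ sends channels $AC\to BD$ to channels $A'C\to BD$. A *realization* of $\Theta$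 consists of a system $R$, an isometry $\mathcal{V}^{A'\to RA}$ and a channel $\mathcal{E}^{RB\to B}$ with $$\Theta[\mathcal{F}^{A\to B}]=\mathcal{E}^{RB\to B}\circ\mathcal{F}^{A\to B}\circ\mathcal{V}^{A'\to RA}\quad\text{for all linear }\mathcal{F}^{A\to B},$$ and it is a *standard form* if $|R|$ is the least possible. A superchannel is *mixing* if it has a standard form in which $\mathcal{E}$ is conditionally unital. Theorem 14. Let $A'$, $A$, $B$ be systems. (1) A channel $\mathcal{N}^{A'B\to AB}$ is $B\not\to A$ signalling if and only if it has the form $$\mathcal{N}^{A'B\to AB}=\mathcal{E}^{RB\to B}\circ\mathcal{V}^{A'\to RA}\qquad(*)$$ for some system $R$, isometry $\mathcal{V}$ and channel $\mathcal{E}$. (2) A channel $\mathcal{N}^{A'B\to AB}$ is conditionally mixing if and only if it has the form $(*)$ with $\mathcal{V}$ an isometry and $\mathcal{E}$ a conditionally unital channel. (3) Every superchannel from $A\to B$ to $A'\to B$ has a realization. The map $\mathbf{f}(\Theta)=\mathcal{E}^{RB\to B}\circ\mathcal{V}^{A'\to RA}$, where $(R,\mathcal{V},\mathcal{E})$ is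 a realization of $\Theta$, does not depend on the choice of the realization, is a bijection from the set of these superchannels onto the set of $B\not\to A$ signalling channels $A'B\to AB$, and restricts to a bijection from the set of mixing superchannels onto the set of conditionally mixing channels $A'B\to AB$. -/

import Mathlib

open scoped Kronecker Matrix ComplexOrder

namespace QMix

/-- Linear maps from the operators on the system with basis `X` to those on the system with
basis `Y` (a finite-dimensional system is given by the finite type labelling its basis, a
composite system by the product of the types). -/
abbrev Superop (X Y : Type*) := Matrix X X ℂ →ₗ[ℂ] Matrix Y Y ℂ

/-- Supermaps: linear maps from superoperators `X → Y` to superoperators `X' → Y'`. -/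
abbrev Supermap (X Y X' Y' : Type*) := Superop X Y →ₗ[ℂ] Superop X' Y'

section Basic

variable {X Y C : Type*}

/-- Renaming of basis labels, used to reorder tensor factors. -/
def relabel (e : X ≃ Y) : Superop X Y :=
  (Matrix.reindexLinearEquiv ℂ ℂ e e).toLinearMap

/-- The block `⟨c| M |c'⟩` of an operator `M` on `XC`. -/
def block (c c' : C) : Matrix (X × C) (X × C) ℂ →ₗ[ℂ] Matrix X X ℂ where
  toFun M := Matrix.of fun x x' => M (x, c) (x', c')
  map_add' _ _ := rfl
  map_smul' _ _ := rfl

/-- `Φ ⊗ id_C`, which applies `Φ` to each block. -/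
def ampliate (C : Type*) (Φ : Superop X Y) : Superop (X × C) (Y × C) where
  toFun M := Matrix.of fun p q => Φ (block p.2 q.2 M) p.1 q.1
  map_add' M N := by
    ext p q
    simp
  map_smul' a M := by
    ext p q
    simp

/-- Partial trace over the second tensor factor. -/
def traceSnd [Fintype Y] (M : Matrix (X × Y) (X × Y) ℂ) : Matrix X X ℂ :=
  Matrix.of fun x x' => ∑ y, M (x, y) (x', y)

/-- Density matrices. -/
def IsState [Fintype X] (ρ : Matrix X X ℂ) : Prop := ρ.PosSemidef ∧ ρ.trace = 1

/-- The uniform (maximally mixed) state. -/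
noncomputable def unif (X : Type*) [Fintype X] [DecidableEq X] : Matrix X X ℂ :=
  (Fintype.card X : ℂ)⁻¹ • 1

def IsCompletelyPositive (Φ : Superop X Y) : Prop :=
  ∀ (k : ℕ) (M : Matrix (X × Fin k) (X × Fin k) ℂ),
    M.PosSemidef → (ampliate (Fin k) Φ M).PosSemidef

def IsTracePreserving [Fintype X] [Fintype Y] (Φ : Superop X Y) : Prop :=
  ∀ M, (Φ M).trace = M.trace

/-- Quantum channels (CPTP maps). -/
def IsChannel [Fintype X] [Fintype Y] (Φ : Superop X Y) : Prop :=
  IsCompletelyPositive Φ ∧ IsTracePreserving Φ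

/-- Doubly stochastic maps: channels that fix the uniform state. -/
def IsDoublyStochastic [Fintype X] [DecidableEq X] (Φ : Superop X X) : Prop :=
  IsChannel Φ ∧ Φ (unif X) = unif X

/-- Isometries between the Hilbert spaces with bases `X` and `Y`. -/
def IsIsometry [Fintype Y] [DecidableEq X] (V : Matrix Y X ℂ) : Prop := Vᴴ * V = 1

/-- `ρ ↦ V ρ V†`. -/
def conjBy [Fintype X] (V : Matrix Y X ℂ) : Superop X Y where
  toFun ρ := V * ρ * Vᴴ
  map_add' M N := by rw [Matrix.mul_add, Matrix.add_mul]
  map_smul' c M := by simp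

end Basic

section Bipartite

variable {R A' A B : Type*}

/-- The map `ω ↦ E (τ ⊗ ω)`. -/
def withSideState (E : Superop (R × B) B) (τ : Matrix R R ℂ) : Superop B B where
  toFun ω := E (τ ⊗ₖ ω)
  map_add' M N := by rw [Matrix.kronecker_add, map_add]
  map_smul' c M := by rw [Matrix.kronecker_smul, map_smul, RingHom.id_apply]

/-- A map `E : RB → B` is conditionally unital if `E (τ ⊗ ·)` is doubly stochastic for every
state `τ` of `R`. -/
def IsConditionallyUnitalPost [Fintype R] [Fintype B] [DecidableEq B]
    (E : Superop (R × B) B) : Prop :=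
  ∀ τ : Matrix R R ℂ, IsState τ → IsDoublyStochastic (withSideState E τ)

/-- A bipartite map `N : A'B → AB` is conditionally unital if it sends `ρ ⊗ u` to some `σ ⊗ u`,
for every state `ρ` of `A'`. -/
def IsConditionallyUnital [Fintype A'] [Fintype A] [Fintype B] [DecidableEq B]
    (N : Superop (A' × B) (A × B)) : Prop :=
  ∀ ρ : Matrix A' A' ℂ, IsState ρ →
    ∃ σ : Matrix A A ℂ, IsState σ ∧ N (ρ ⊗ₖ unif B) = σ ⊗ₖ unif B

/-- No signalling from `B` to `A`: the reduced output on `A` depends only on the reduced input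
on `A'`. -/
def IsNonSignalling [Fintype A'] [Fintype B] (N : Superop (A' × B) (A × B)) : Prop :=
  ∀ ρ₁ ρ₂ : Matrix (A' × B) (A' × B) ℂ, IsState ρ₁ → IsState ρ₂ →
    traceSnd ρ₁ = traceSnd ρ₂ → traceSnd (N ρ₁) = traceSnd (N ρ₂)

/-- Conditionally mixing channels. -/
def IsConditionallyMixing [Fintype A'] [Fintype A] [Fintype B] [DecidableEq B]
    (N : Superop (A' × B) (A × B)) : Prop :=
  IsChannel N ∧ IsNonSignalling N ∧ IsConditionallyUnital N

/-- `(R × A) × B ≃ (R × B) × A`. -/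
def shuffle (R A B : Type*) : (R × A) × B ≃ (R × B) × A where
  toFun p := ((p.1.1, p.2), p.1.2)
  invFun p := ((p.1.1, p.2), p.1.2)
  left_inv _ := rfl
  right_inv _ := rfl

/-- The bipartite map `E^{RB → B} ∘ V^{A' → RA}` from `A'B` to `AB`: first `V ⊗ id_B`, then
`E ⊗ id_A`. -/
def semilocal [Fintype A'] (V : Matrix (R × A) A' ℂ) (E : Superop (R × B) B) :
    Superop (A' × B) (A × B) :=
  relabel (Equiv.prodComm B A) ∘ₗ ampliate A E ∘ₗ relabel (shuffle R A B) ∘ₗ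
    ampliate B (conjBy V)

/-- The map `E^{RB → B} ∘ (id_R ⊗ F^{A → B}) ∘ V^{A' → RA}` from `A'` to `B`. -/
def prePost [Fintype A'] (V : Matrix (R × A) A' ℂ) (E : Superop (R × B) B)
    (F : Superop A B) : Superop A' B :=
  E ∘ₗ relabel (Equiv.prodComm B R) ∘ₗ ampliate R F ∘ₗ relabel (Equiv.prodComm R A) ∘ₗ
    conjBy V

end Bipartite

section Supermaps

variable {X Y X' Y' C D : Type*}

/-- The component `x ↦ ⟨d| F (x ⊗ |c⟩⟨c'|) |d'⟩` of a map `F : XC → YD`. -/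
def component [DecidableEq C] (F : Superop (X × C) (Y × D)) (c c' : C) (d d' : D) :
    Superop X Y where
  toFun M := Matrix.of fun y y' => F (M ⊗ₖ Matrix.single c c' (1 : ℂ)) (y, d) (y', d')
  map_add' M N := by
    ext y y'
    simp [Matrix.add_kronecker]
  map_smul' a M := by
    ext y y'
    simp [Matrix.smul_kronecker]

/-- `(Θ ⊗ 𝟙^{(C → D)})[F]`: the supermap `Θ` acts on each component of `F`. -/
def superAmpliate [Fintype C] [DecidableEq C] (Θ : Supermap X Y X' Y')
    (F : Superop (X × C) (Y × D)) : Superop (X' × C) (Y' × D) where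
  toFun M := Matrix.of fun p q => ∑ c, ∑ c',
    Θ (component F c c' p.2 q.2) (block c c' M) p.1 q.1
  map_add' M N := by
    ext p q
    simp [Finset.sum_add_distrib]
  map_smul' a M := by
    ext p q
    simp [Finset.mul_sum]

/-- Superchannels: supermaps `Θ` such that `Θ ⊗ 𝟙^{(C → D)}` sends channels to channels, for
all ancillary systems `C` and `D`. -/
def IsSuperchannel [Fintype X] [Fintype Y] [Fintype X'] [Fintype Y']
    (Θ : Supermap X Y X' Y') : Prop :=
  ∀ (k l : ℕ) (F : Superop (X × Fin k) (Y × Fin l)),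
    IsChannel F → IsChannel (superAmpliate Θ F)

variable {R A' A B : Type*}

/-- `Θ` is implemented by the isometry `V : A' → RA` and the channel `E : RB → B`. -/
def IsRealization [Fintype A'] [DecidableEq A'] [Fintype A] [Fintype B] [Fintype R]
    (Θ : Supermap A B A' B) (V : Matrix (R × A) A' ℂ) (E : Superop (R × B) B) : Prop :=
  IsIsometry V ∧ IsChannel E ∧ ∀ F : Superop A B, Θ F = prePost V E F

/-- Standard form: a realization whose auxiliary system has the least possible dimension. -/
def IsStandardForm [Fintype A'] [DecidableEq A'] [Fintype A] [Fintype B]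
    (Θ : Supermap A B A' B) (r : ℕ) (V : Matrix (Fin r × A) A' ℂ)
    (E : Superop (Fin r × B) B) : Prop :=
  IsRealization Θ V E ∧
    ∀ (r' : ℕ) (V' : Matrix (Fin r' × A) A' ℂ) (E' : Superop (Fin r' × B) B),
      IsRealization Θ V' E' → r ≤ r'

/-- Mixing superchannels: the post-processing of the standard form is conditionally unital. -/
def IsMixing [Fintype A'] [DecidableEq A'] [Fintype A] [Fintype B] [DecidableEq B]
    (Θ : Supermap A B A' B) : Prop :=
  IsSuperchannel Θ ∧ ∃ (r : ℕ) (V : Matrix (Fin r × A) A' ℂ) (E : Superop (Fin r × B) B),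
    IsStandardForm Θ r V E ∧ IsConditionallyUnitalPost E

end Supermaps

end QMix

/-!
A non-signalling channel `N : A'B → AB` has a reduced channel `A' → A`; let `V : A' → RA` be a
minimal Stinespring dilation of it. A Stinespring dilation of `N`, with the output on `B` counted
as environment, and `V ⊗ 1_B` both dilate `N` followed by the partial trace over `B`, and the
second one is minimal, so the first factors through it by an isometry `RB → SB`. Tracing out `S`
gives `E : RB → B` with `N = E ∘ V`.

Supermaps correspond linearly and injectively to bipartite maps by evaluation on the swap, and a
realization `(V, E)` goes to `E ∘ V`. A superchannel goes to a non-signalling channel because it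
sends a map with traceless outputs to a map with traceless outputs: such a map is, up to scale
and taking real and imaginary parts, the difference of two channels. Factorizing its bipartite
channel as above gives a realization.

For a minimal `V`, any other realization has an auxiliary system into which `R` embeds
isometrically, so `(V, E)` is a standard form. Moreover the blocks `⟨a| V X V† |a'⟩` span all
operators on `R`, so that `E (τ ⊗ u)` is a multiple of `u` for every `τ` as soon as `E ∘ V` is
conditionally unital.
-/

namespace QMix

section Matrix

variable {𝕜 k l m : Type*} [RCLike 𝕜]

lemma exists_thin_spectral_decomposition [Fintype m] {M : Matrix m m 𝕜} (hM : M.PosSemidef) :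
    ∃ (r : ℕ) (W : Matrix m (Fin r) 𝕜) (w : Fin r → ℝ), (∀ j, 0 < w j) ∧ Wᴴ * W = 1 ∧
      M = W * Matrix.diagonal (fun j => (w j : 𝕜)) * Wᴴ := by
  classical
  let U : Matrix m m 𝕜 := hM.1.eigenvectorUnitary
  let d := hM.1.eigenvalues
  have hU : Uᴴ * U = 1 := Unitary.coe_star_mul_self hM.1.eigenvectorUnitary
  have hMU : M = U * Matrix.diagonal (RCLike.ofReal ∘ d) * Uᴴ := hM.1.spectral_theorem
  let e := Fintype.equivFin {i // d i ≠ 0}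
  let c (j : Fin (Fintype.card {i // d i ≠ 0})) : m := e.symm j
  have hc : c.Injective := Subtype.val_injective.comp e.symm.injective
  refine ⟨_, U.submatrix id c, d ∘ c,
    fun j => (hM.eigenvalues_nonneg _).lt_of_ne (e.symm j).2.symm, ?_, ?_⟩
  · rw [Matrix.conjTranspose_submatrix, ← Matrix.submatrix_mul _ _ c id c Function.bijective_id,
      hU, Matrix.submatrix_one _ hc]
  · ext x y
    conv_lhs => rw [hMU]
    rw [Matrix.mul_apply, Matrix.mul_apply]
    simp only [Matrix.mul_diagonal]
    refine (Fintype.sum_of_injective c hc _ _ (fun i hi => ?_) fun _ => rfl).symm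
    have hdi : d i = 0 := by
      by_contra h
      exact hi ⟨e ⟨i, h⟩, by simp [c]⟩
    simp [hdi]

lemma exists_eq_conjTranspose_mul_self_of_posSemidef [Fintype m] {M : Matrix m m 𝕜}
    (hM : M.PosSemidef) :
    ∃ (r : ℕ) (L : Matrix (Fin r) m 𝕜) (P : Matrix m (Fin r) 𝕜), M = Lᴴ * L ∧ L * P = 1 := by
  obtain ⟨r, W, w, hw, hW, rfl⟩ := exists_thin_spectral_decomposition hM
  let s : Fin r → 𝕜 := fun j => (√(w j) : ℝ)
  have hs : ∀ j, s j ≠ 0 := fun j => RCLike.ofReal_ne_zero.mpr (Real.sqrt_ne_zero'.mpr (hw j))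
  have hsq : Matrix.diagonal (fun j => (w j : 𝕜)) = (Matrix.diagonal s)ᴴ * Matrix.diagonal s := by
    rw [Matrix.diagonal_conjTranspose, Matrix.diagonal_mul_diagonal]
    congr 1
    funext j
    simp [s, ← RCLike.ofReal_mul, Real.mul_self_sqrt (hw j).le]
  refine ⟨r, Matrix.diagonal s * Wᴴ, W * Matrix.diagonal s⁻¹, ?_, ?_⟩
  · simp only [hsq, Matrix.conjTranspose_mul, Matrix.conjTranspose_conjTranspose,
      Matrix.mul_assoc]
  · calc Matrix.diagonal s * Wᴴ * (W * Matrix.diagonal s⁻¹)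
        = Matrix.diagonal s * (Wᴴ * W) * Matrix.diagonal s⁻¹ := by
          simp only [Matrix.mul_assoc]
      _ = 1 := by
          rw [hW, Matrix.mul_one, Matrix.diagonal_mul_diagonal]
          simp [hs]

lemma exists_isometry_of_gram_eq [Fintype k] [Fintype l] [Fintype m] [DecidableEq l]
    {K : Matrix k m 𝕜} {L : Matrix l m 𝕜} {P : Matrix m l 𝕜} (hLP : L * P = 1)
    (h : Kᴴ * K = Lᴴ * L) : ∃ U : Matrix k l 𝕜, Uᴴ * U = 1 ∧ U * L = K := by
  classical
  refine ⟨K * P, ?_, ?_⟩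
  · calc (K * P)ᴴ * (K * P) = Pᴴ * (Kᴴ * K) * P := by
          simp only [Matrix.conjTranspose_mul, Matrix.mul_assoc]
      _ = (L * P)ᴴ * (L * P) := by
          simp only [h, Matrix.conjTranspose_mul, Matrix.mul_assoc]
      _ = 1 := by rw [hLP, Matrix.conjTranspose_one, Matrix.one_mul]
  · have hker : Kᴴ * K * (P * L - 1) = 0 := by
      rw [h, Matrix.mul_assoc, Matrix.mul_sub L, ← Matrix.mul_assoc L, hLP, Matrix.one_mul,
        Matrix.mul_one, sub_self, Matrix.mul_zero]
    rw [Matrix.conjTranspose_mul_self_mul_eq_zero, Matrix.mul_sub, Matrix.mul_one,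
      sub_eq_zero] at hker
    rw [Matrix.mul_assoc, hker]

variable {X Y : Type*}

lemma IsIsometry.card_le [Fintype X] [Fintype Y] [DecidableEq X] {V : Matrix Y X ℂ}
    (hV : IsIsometry V) : Fintype.card X ≤ Fintype.card Y := by
  have h : (Vᴴ * V).rank = Fintype.card X := by rw [show Vᴴ * V = 1 from hV, Matrix.rank_one]
  rw [← h, Matrix.rank_conjTranspose_mul_self]
  exact V.rank_le_card_height

open scoped MatrixOrder Matrix.Norms.L2Operator in
lemma exists_one_add_smul_posSemidef [Finite X] [DecidableEq X] {H : Matrix X X ℂ}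
    (hH : H.IsHermitian) : ∃ c : ℝ, 0 < c ∧ (1 + (c : ℂ) • H).PosSemidef := by
  cases nonempty_fintype X
  have hlow : (H - -algebraMap ℝ (Matrix X X ℂ) ‖H‖).PosSemidef :=
    Matrix.le_iff.mp (IsSelfAdjoint.neg_algebraMap_norm_le_self hH)
  refine ⟨(‖H‖ + 1)⁻¹, by positivity, ?_⟩
  have h : (((‖H‖ + 1)⁻¹ : ℝ) • (H - -algebraMap ℝ (Matrix X X ℂ) ‖H‖ + 1)).PosSemidef :=
    (hlow.add Matrix.PosSemidef.one).smul (by positivity)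
  convert h using 1
  have hne : (‖H‖ + 1) ≠ 0 := by positivity
  rw [Algebra.algebraMap_eq_smul_one, Complex.coe_smul]
  match_scalars <;> field_simp

end Matrix

section States

variable {X Y E : Type*} [AddCommGroup E] [Module ℂ E]

open scoped MatrixOrder Matrix.Norms.L2Operator in
lemma span_posSemidef [Finite X] :
    Submodule.span ℂ {ρ : Matrix X X ℂ | ρ.PosSemidef} = ⊤ := by
  classical
  cases nonempty_fintype X
  simpa only [Matrix.nonneg_iff_posSemidef] using
    CStarAlgebra.span_nonneg (A := Matrix X X ℂ)

variable [Fintype X]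

lemma isState_unif [DecidableEq X] [Nonempty X] : IsState (unif X) :=
  ⟨Matrix.PosSemidef.one.smul (by positivity), by simp [unif, Matrix.trace_smul]⟩

lemma IsState.kronecker [Fintype Y] {ρ : Matrix X X ℂ} {σ : Matrix Y Y ℂ} (hρ : IsState ρ)
    (hσ : IsState σ) : IsState (ρ ⊗ₖ σ) :=
  ⟨hρ.1.kronecker hσ.1, by rw [Matrix.trace_kronecker, hρ.2, hσ.2, mul_one]⟩

lemma span_isState : Submodule.span ℂ {ρ : Matrix X X ℂ | IsState ρ} = ⊤ := by
  rw [eq_top_iff, ← span_posSemidef, Submodule.span_le]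
  intro ρ hρ
  by_cases h0 : ρ.trace = 0
  · rw [hρ.trace_eq_zero_iff.mp h0]
    exact zero_mem _
  · have hs : IsState (ρ.trace⁻¹ • ρ) :=
      ⟨hρ.smul (inv_nonneg.mpr hρ.trace_nonneg), by simp [Matrix.trace_smul, h0]⟩
    rw [← smul_inv_smul₀ h0 ρ]
    exact Submodule.smul_mem _ _ (Submodule.subset_span hs)

lemma linearMap_ext_isState {f g : Matrix X X ℂ →ₗ[ℂ] E}
    (h : ∀ ρ : Matrix X X ℂ, IsState ρ → f ρ = g ρ) : f = g :=
  LinearMap.ext_on span_isState h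

lemma linearMap_ext_kronecker_isState [Fintype Y] {f g : Matrix (X × Y) (X × Y) ℂ →ₗ[ℂ] E}
    (h : ∀ (ρ : Matrix X X ℂ) (σ : Matrix Y Y ℂ), IsState ρ → IsState σ →
      f (ρ ⊗ₖ σ) = g (ρ ⊗ₖ σ)) : f = g := by
  classical
  let κ : Matrix X X ℂ →ₗ[ℂ] Matrix Y Y ℂ →ₗ[ℂ] Matrix (X × Y) (X × Y) ℂ :=
    Matrix.kroneckerBilinear
  have hκ : κ.compr₂ f = κ.compr₂ g := linearMap_ext_isState fun ρ hρ =>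
    linearMap_ext_isState fun σ hσ => h ρ σ hρ hσ
  refine Matrix.ext_linearMap _ fun p q => LinearMap.ext_ring ?_
  have hpq : f (Matrix.single p.1 q.1 1 ⊗ₖ Matrix.single p.2 q.2 1) =
      g (Matrix.single p.1 q.1 1 ⊗ₖ Matrix.single p.2 q.2 1) :=
    LinearMap.congr_fun₂ hκ _ _
  rwa [Matrix.single_kronecker_single, mul_one] at hpq

end States

section Structural

variable {X Y Z C : Type*}

@[simp] lemma block_apply (c c' : C) (M : Matrix (X × C) (X × C) ℂ) (x x' : X) :
    block c c' M x x' = M (x, c) (x', c') := rfl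

@[simp] lemma ampliate_apply (Φ : Superop X Y) (M : Matrix (X × C) (X × C) ℂ) (p q : Y × C) :
    ampliate C Φ M p q = Φ (block p.2 q.2 M) p.1 q.1 := rfl

@[simp] lemma relabel_apply (e : X ≃ Y) (M : Matrix X X ℂ) (y y' : Y) :
    relabel e M y y' = M (e.symm y) (e.symm y') := rfl

@[simp] lemma conjBy_apply [Fintype X] (V : Matrix Y X ℂ) (M : Matrix X X ℂ) :
    conjBy V M = V * M * Vᴴ := rfl

@[simp] lemma traceSnd_apply [Fintype Y] (M : Matrix (X × Y) (X × Y) ℂ) (x x' : X) :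
    traceSnd M x x' = ∑ y, M (x, y) (x', y) := rfl

lemma block_ampliate (Φ : Superop X Y) (M : Matrix (X × C) (X × C) ℂ) (c c' : C) :
    block c c' (ampliate C Φ M) = Φ (block c c' M) := rfl

lemma ampliate_comp (Φ : Superop Y Z) (Ψ : Superop X Y) :
    ampliate C (Φ ∘ₗ Ψ) = ampliate C Φ ∘ₗ ampliate C Ψ := rfl

lemma trace_eq_sum_block [Fintype X] [Fintype C] (M : Matrix (X × C) (X × C) ℂ) :
    M.trace = ∑ c, (block c c M).trace := by
  simp only [Matrix.trace, Matrix.diag_apply, block_apply, Fintype.sum_prod_type]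
  exact Finset.sum_comm

lemma trace_traceSnd [Fintype X] [Fintype C] (M : Matrix (X × C) (X × C) ℂ) :
    (traceSnd M).trace = M.trace := by
  simp [Matrix.trace, Fintype.sum_prod_type]

lemma eq_sum_block_kronecker [Fintype C] [DecidableEq C] (M : Matrix (X × C) (X × C) ℂ) :
    M = ∑ c, ∑ c', block c c' M ⊗ₖ Matrix.single c c' (1 : ℂ) := by
  ext ⟨x, c⟩ ⟨x', c'⟩
  simp [Matrix.sum_apply, Matrix.single_apply, ite_and]

lemma block_kronecker (M : Matrix X X ℂ) (N : Matrix C C ℂ) (c c' : C) :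
    block c c' (M ⊗ₖ N) = N c c' • M := by
  ext x x'
  simp [mul_comm]

lemma traceSnd_kronecker [Fintype C] (M : Matrix X X ℂ) (N : Matrix C C ℂ) :
    traceSnd (M ⊗ₖ N) = N.trace • M := by
  ext x x'
  simp [Matrix.trace, ← Finset.mul_sum, mul_comm]

lemma IsState.traceSnd_kronecker [Fintype C] {σ : Matrix C C ℂ} (hσ : IsState σ)
    (ρ : Matrix X X ℂ) : traceSnd (ρ ⊗ₖ σ) = ρ := by
  rw [QMix.traceSnd_kronecker, hσ.2, one_smul]

end Structural

section Channels

variable {X Y Z C : Type*}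

lemma IsCompletelyPositive.ampliate_posSemidef [Finite C] {Φ : Superop X Y}
    (h : IsCompletelyPositive Φ) {M : Matrix (X × C) (X × C) ℂ} (hM : M.PosSemidef) :
    (ampliate C Φ M).PosSemidef := by
  cases nonempty_fintype C
  let e := Fintype.equivFin C
  convert (h _ _ (hM.submatrix (Prod.map id e.symm))).submatrix (Prod.map id e) using 1
  ext p q
  have hblock : block p.2 q.2 M = block (e p.2) (e q.2)
      (M.submatrix (Prod.map id e.symm) (Prod.map id e.symm)) := by
    ext x x'
    simp
  simp [hblock]

lemma IsCompletelyPositive.comp {Φ : Superop Y Z} {Ψ : Superop X Y}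
    (hΦ : IsCompletelyPositive Φ) (hΨ : IsCompletelyPositive Ψ) :
    IsCompletelyPositive (Φ ∘ₗ Ψ) := fun k M hM => by
  rw [ampliate_comp]
  exact hΦ k _ (hΨ k M hM)

lemma IsCompletelyPositive.ampliate [Finite C] {Φ : Superop X Y}
    (h : IsCompletelyPositive Φ) : IsCompletelyPositive (ampliate C Φ) := fun k _ hM =>
  (h.ampliate_posSemidef (hM.submatrix (Equiv.prodAssoc X C (Fin k)).symm)).submatrix
    (Equiv.prodAssoc Y C (Fin k))

lemma ampliate_conjBy [Fintype X] [Fintype C] [DecidableEq C] (V : Matrix Y X ℂ) :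
    ampliate C (conjBy V) = conjBy (V ⊗ₖ (1 : Matrix C C ℂ)) := by
  refine LinearMap.ext fun M => ?_
  ext ⟨y, c⟩ ⟨y', c'⟩
  simp [Matrix.mul_apply, Fintype.sum_prod_type, Matrix.one_apply, Finset.sum_mul,
    apply_ite (starRingEnd ℂ)]

lemma isCompletelyPositive_conjBy [Fintype X] [Finite Y] (V : Matrix Y X ℂ) :
    IsCompletelyPositive (conjBy V) := fun k M hM => by
  rw [ampliate_conjBy]
  exact hM.mul_mul_conjTranspose_same _

/-- The partial trace over `Y` as a linear map. -/
def partialTrace (X Y : Type*) [Fintype Y] : Superop (X × Y) X where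
  toFun := traceSnd
  map_add' M N := by
    ext x x'
    simp [Finset.sum_add_distrib]
  map_smul' a M := by
    ext x x'
    simp [Finset.mul_sum]

lemma isCompletelyPositive_partialTrace [Fintype Y] :
    IsCompletelyPositive (partialTrace X Y) := fun k M hM => by
  have h : ampliate (Fin k) (partialTrace X Y) M =
      ∑ y, M.submatrix (fun p => ((p.1, y), p.2)) (fun p => ((p.1, y), p.2)) := by
    ext p q
    simp [partialTrace, Matrix.sum_apply]
  rw [h]
  exact Matrix.posSemidef_sum _ fun y _ => hM.submatrix _

/-- The map `ρ ↦ ρ ⊗ σ`, which adjoins a system in the state `σ`. -/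
noncomputable def adjoinState (X : Type*) (σ : Matrix Y Y ℂ) : Superop X (X × Y) :=
  (Matrix.kroneckerBilinear (R := ℂ) (α := ℂ)).flip σ

lemma adjoinState_apply (σ : Matrix Y Y ℂ) (ρ : Matrix X X ℂ) :
    adjoinState X σ ρ = ρ ⊗ₖ σ := rfl

variable [Fintype X] [Fintype Y] [Fintype Z]

lemma IsChannel.comp {Φ : Superop Y Z} {Ψ : Superop X Y} (hΦ : IsChannel Φ) (hΨ : IsChannel Ψ) :
    IsChannel (Φ ∘ₗ Ψ) :=
  ⟨hΦ.1.comp hΨ.1, fun M => (hΦ.2 _).trans (hΨ.2 M)⟩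

lemma IsChannel.ampliate [Fintype C] {Φ : Superop X Y} (h : IsChannel Φ) :
    IsChannel (ampliate C Φ) :=
  ⟨h.1.ampliate, fun M => by simp only [trace_eq_sum_block, block_ampliate, h.2 _]⟩

lemma isChannel_relabel (e : X ≃ Y) : IsChannel (relabel e) :=
  ⟨fun _ _ hM => hM.submatrix (Prod.map e.symm id), fun M => by
    simpa [Matrix.trace] using Equiv.sum_comp e.symm fun x => M x x⟩

lemma isChannel_partialTrace : IsChannel (partialTrace X Y) :=
  ⟨isCompletelyPositive_partialTrace, trace_traceSnd⟩

lemma isChannel_adjoinState {σ : Matrix Y Y ℂ} (hσ : IsState σ) : IsChannel (adjoinState X σ) := by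
  refine ⟨fun k M hM => ?_, fun M => ?_⟩
  · have h : ampliate (Fin k) (adjoinState X σ) M =
        (M ⊗ₖ σ).submatrix (fun p => ((p.1.1, p.2), p.1.2)) (fun p => ((p.1.1, p.2), p.1.2)) := by
      ext p q
      simp [adjoinState_apply]
    rw [h]
    exact (hM.kronecker hσ.1).submatrix _
  · rw [adjoinState_apply, Matrix.trace_kronecker, hσ.2, mul_one]

lemma isTracePreserving_conjBy_iff [DecidableEq X] {V : Matrix Y X ℂ} :
    IsTracePreserving (conjBy V) ↔ IsIsometry V := by
  have h : ∀ M : Matrix X X ℂ, (conjBy V M).trace = (Vᴴ * V * M).trace := fun M => by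
    rw [conjBy_apply, Matrix.trace_mul_cycle]
  simp only [IsTracePreserving, IsIsometry, h, Matrix.ext_iff_trace_mul_right, Matrix.one_mul]

lemma isChannel_conjBy [DecidableEq X] {V : Matrix Y X ℂ} (h : IsIsometry V) :
    IsChannel (conjBy V) :=
  ⟨isCompletelyPositive_conjBy V, isTracePreserving_conjBy_iff.mpr h⟩

lemma IsChannel.isState {Φ : Superop X Y} (h : IsChannel Φ) {ρ : Matrix X X ℂ}
    (hρ : IsState ρ) : IsState (Φ ρ) :=
  ⟨(h.1.ampliate_posSemidef (C := Unit) (hρ.1.submatrix Prod.fst)).submatrix fun y => (y, ()),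
    (h.2 _).trans hρ.2⟩

lemma isChannel_withSideState {E : Superop (X × Y) Y} (hE : IsChannel E) {τ : Matrix X X ℂ}
    (hτ : IsState τ) : IsChannel (withSideState E τ) := by
  have h : withSideState E τ = E ∘ₗ relabel (Equiv.prodComm Y X) ∘ₗ adjoinState Y τ := by
    refine LinearMap.ext fun ω => congrArg E ?_
    ext p q
    exact mul_comm _ _
  rw [h]
  exact hE.comp ((isChannel_relabel _).comp (isChannel_adjoinState hτ))

lemma isConditionallyUnitalPost_iff [DecidableEq Y] {E : Superop (X × Y) Y} (hE : IsChannel E) :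
    IsConditionallyUnitalPost E ↔ ∀ τ : Matrix X X ℂ, E (τ ⊗ₖ unif Y) = τ.trace • unif Y := by
  refine ⟨fun h => ?_, fun h τ hτ => ⟨isChannel_withSideState hE hτ, ?_⟩⟩
  · have hlin : E ∘ₗ adjoinState X (unif Y) =
        (Matrix.traceLinearMap X ℂ ℂ).smulRight (unif Y) :=
      linearMap_ext_isState fun τ hτ => by
        simpa [adjoinState_apply, hτ.2, withSideState] using (h τ hτ).2
    exact fun τ => LinearMap.congr_fun hlin τ
  · simpa [hτ.2, withSideState] using h τ

end Channels

section Dilation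

variable {X Y R S : Type*}

/-- The Choi matrix of a superoperator. -/
def choi [DecidableEq X] : Superop X Y →ₗ[ℂ] Matrix (Y × X) (Y × X) ℂ where
  toFun Φ := Matrix.of fun p q => Φ (Matrix.single p.2 q.2 1) p.1 q.1
  map_add' _ _ := rfl
  map_smul' _ _ := rfl

lemma choi_apply [DecidableEq X] (Φ : Superop X Y) (p q : Y × X) :
    choi Φ p q = Φ (Matrix.single p.2 q.2 1) p.1 q.1 := rfl

lemma choi_injective [Finite X] [DecidableEq X] :
    Function.Injective (choi : Superop X Y → Matrix (Y × X) (Y × X) ℂ) := fun Φ Ψ h =>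
  Matrix.ext_linearMap _ fun x x' => LinearMap.ext_ring <| by
    ext y y'
    exact congrFun₂ h (y, x) (y', x')

lemma IsCompletelyPositive.choi_posSemidef [Finite X] [DecidableEq X] {Φ : Superop X Y}
    (h : IsCompletelyPositive Φ) : (choi Φ).PosSemidef := by
  let ω : X × X → ℂ := fun p => if p.1 = p.2 then 1 else 0
  have hω : ∀ c c' : X, block c c' (Matrix.vecMulVec ω (star ω)) = Matrix.single c c' 1 := by
    intro c c'
    ext x x'
    by_cases hc : c = x <;> by_cases hc' : c' = x' <;>
      simp [ω, Matrix.vecMulVec_apply, hc, hc', eq_comm (a := x), eq_comm (a := x')]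
  have hchoi : choi Φ = QMix.ampliate X Φ (Matrix.vecMulVec ω (star ω)) := by
    ext p q
    rw [choi_apply, ampliate_apply, hω]
  rw [hchoi]
  exact h.ampliate_posSemidef (Matrix.posSemidef_vecMulVec_self_star ω)

/-- The map `ρ ↦ tr_R (V ρ V†)`, of which `V` is a Stinespring dilation when it is an isometry. -/
def stinespring [Fintype X] [Fintype R] (V : Matrix (R × Y) X ℂ) : Superop X Y :=
  partialTrace Y R ∘ₗ relabel (Equiv.prodComm R Y) ∘ₗ conjBy V

lemma stinespring_apply [Fintype X] [Fintype R] (V : Matrix (R × Y) X ℂ) (M : Matrix X X ℂ)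
    (y y' : Y) : stinespring V M y y' = ∑ r, (V * M * Vᴴ) (r, y) (r, y') := rfl

/-- `V : X → RY` as an `R × (Y × X)` matrix; its row space is the part of the environment `R`
that `V` reaches. -/
def environmentRows (V : Matrix (R × Y) X ℂ) : Matrix R (Y × X) ℂ :=
  Matrix.of fun r p => V (r, p.1) p.2

/-- `V` is a minimal dilation of `stinespring V`: the rows of `environmentRows V` are linearly
independent, stated as the existence of a right inverse. -/
def IsMinimalDilation [Fintype X] [Fintype Y] [DecidableEq R] (V : Matrix (R × Y) X ℂ) : Prop :=
  ∃ P : Matrix (Y × X) R ℂ, environmentRows V * P = 1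

variable [Fintype X] [Fintype R]

lemma conjTranspose_environmentRows_mul_self [DecidableEq X] (V : Matrix (R × Y) X ℂ) :
    (environmentRows V)ᴴ * environmentRows V = (choi (stinespring V))ᵀ := by
  ext p q
  simp [choi_apply, stinespring_apply, environmentRows, Matrix.mul_apply, Matrix.single_apply,
    ite_and, mul_comm]

lemma isCompletelyPositive_stinespring [Finite Y] (V : Matrix (R × Y) X ℂ) :
    IsCompletelyPositive (stinespring V) := by
  cases nonempty_fintype Y
  exact isCompletelyPositive_partialTrace.comp
    ((isChannel_relabel _).1.comp (isCompletelyPositive_conjBy V))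

variable [Fintype Y]

lemma isTracePreserving_stinespring_iff [DecidableEq X] {V : Matrix (R × Y) X ℂ} :
    IsTracePreserving (stinespring V) ↔ IsIsometry V := by
  have h : ∀ M, (stinespring V M).trace = (conjBy V M).trace := fun M =>
    (isChannel_partialTrace.comp (isChannel_relabel (Equiv.prodComm R Y))).2 (conjBy V M)
  simp only [← isTracePreserving_conjBy_iff, IsTracePreserving, h]

lemma isChannel_stinespring [DecidableEq X] {V : Matrix (R × Y) X ℂ} (hV : IsIsometry V) :
    IsChannel (stinespring V) :=
  ⟨isCompletelyPositive_stinespring V, isTracePreserving_stinespring_iff.mpr hV⟩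

lemma exists_isMinimalDilation_of_choi_posSemidef [DecidableEq X] {Φ : Superop X Y}
    (h : (choi Φ).PosSemidef) :
    ∃ (r : ℕ) (V : Matrix (Fin r × Y) X ℂ), IsMinimalDilation V ∧ Φ = stinespring V := by
  obtain ⟨r, L, P, hL, hP⟩ := exists_eq_conjTranspose_mul_self_of_posSemidef h.transpose
  let V : Matrix (Fin r × Y) X ℂ := Matrix.of fun p x => L p.1 (p.2, x)
  have hV : environmentRows V = L := rfl
  refine ⟨r, V, ⟨P, hV ▸ hP⟩, choi_injective (Matrix.transpose_injective ?_)⟩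
  rw [← conjTranspose_environmentRows_mul_self, hV, hL]

lemma IsChannel.exists_isMinimalDilation [DecidableEq X] {Φ : Superop X Y} (h : IsChannel Φ) :
    ∃ (r : ℕ) (V : Matrix (Fin r × Y) X ℂ),
      IsIsometry V ∧ IsMinimalDilation V ∧ Φ = stinespring V := by
  obtain ⟨r, V, hV, rfl⟩ := exists_isMinimalDilation_of_choi_posSemidef h.1.choi_posSemidef
  exact ⟨r, V, isTracePreserving_stinespring_iff.mp h.2, hV, rfl⟩

lemma IsMinimalDilation.exists_isIsometry [Fintype S] [DecidableEq R] {V : Matrix (R × Y) X ℂ}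
    (hV : IsMinimalDilation V) {W : Matrix (S × Y) X ℂ} (h : stinespring W = stinespring V) :
    ∃ U : Matrix S R ℂ, IsIsometry U ∧ U * environmentRows V = environmentRows W := by
  classical
  obtain ⟨P, hP⟩ := hV
  refine exists_isometry_of_gram_eq hP ?_
  rw [conjTranspose_environmentRows_mul_self, conjTranspose_environmentRows_mul_self, h]

end Dilation

lemma isCompletelyPositive_of_choi_posSemidef {X Y : Type*} [Finite X] [DecidableEq X] [Finite Y]
    {Φ : Superop X Y} (h : (choi Φ).PosSemidef) : IsCompletelyPositive Φ := by
  cases nonempty_fintype X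
  cases nonempty_fintype Y
  obtain ⟨r, V, -, rfl⟩ := exists_isMinimalDilation_of_choi_posSemidef h
  exact isCompletelyPositive_stinespring V

section NonSignalling

variable {A' A B : Type*} [Fintype A'] [Fintype B]

lemma isNonSignalling_of_partialTrace_comp {N : Superop (A' × B) (A × B)} {Φ : Superop A' A}
    (h : partialTrace A B ∘ₗ N = Φ ∘ₗ partialTrace A' B) : IsNonSignalling N :=
  fun ρ₁ ρ₂ _ _ hρ => by
    calc traceSnd (N ρ₁) = Φ (traceSnd ρ₁) := LinearMap.congr_fun h ρ₁
      _ = Φ (traceSnd ρ₂) := by rw [hρ]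
      _ = traceSnd (N ρ₂) := (LinearMap.congr_fun h ρ₂).symm

variable [DecidableEq B]

/-- The map `A' → A` obtained from `N : A'B → AB` by feeding in the uniform state on `B` and
discarding the output on `B`. -/
noncomputable def reducedMap (N : Superop (A' × B) (A × B)) : Superop A' A :=
  partialTrace A B ∘ₗ N ∘ₗ adjoinState A' (unif B)

lemma IsChannel.reducedMap [Fintype A] [Nonempty B] {N : Superop (A' × B) (A × B)}
    (hN : IsChannel N) : IsChannel (reducedMap N) :=
  isChannel_partialTrace.comp (hN.comp (isChannel_adjoinState isState_unif))

lemma partialTrace_comp_of_kronecker {N : Superop (A' × B) (A × B)}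
    (h : ∀ (ρ : Matrix A' A' ℂ) (σ : Matrix B B ℂ), IsState ρ → IsState σ →
      traceSnd (N (ρ ⊗ₖ σ)) = traceSnd (N (ρ ⊗ₖ unif B))) :
    partialTrace A B ∘ₗ N = reducedMap N ∘ₗ partialTrace A' B :=
  linearMap_ext_kronecker_isState fun ρ σ hρ hσ => by
    have hρσ : partialTrace A' B (ρ ⊗ₖ σ) = ρ := hσ.traceSnd_kronecker ρ
    rw [LinearMap.comp_apply, LinearMap.comp_apply, hρσ]
    exact h ρ σ hρ hσ

lemma IsNonSignalling.partialTrace_comp [Nonempty B] {N : Superop (A' × B) (A × B)}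
    (h : IsNonSignalling N) :
    partialTrace A B ∘ₗ N = reducedMap N ∘ₗ partialTrace A' B :=
  partialTrace_comp_of_kronecker fun ρ σ hρ hσ =>
    h _ _ (hρ.kronecker hσ) (hρ.kronecker isState_unif) <| by
      rw [hσ.traceSnd_kronecker, isState_unif.traceSnd_kronecker]

end NonSignalling

section Semilocal

variable {X R S A' A B : Type*} [Fintype A']

/-- `V ⊗ 1_B`, regarded as a dilation with environment `RB`. -/
def ampliateDilation (B : Type*) [DecidableEq B] (V : Matrix (R × A) A' ℂ) :
    Matrix ((R × B) × A) (A' × B) ℂ :=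
  (V ⊗ₖ (1 : Matrix B B ℂ)).submatrix (shuffle R A B).symm id

/-- A dilation with output `AB`, regarded as one with output `A` by counting `B` as part of the
environment. -/
def absorbOutput (K : Matrix (S × (A × B)) X ℂ) : Matrix ((S × B) × A) X ℂ :=
  K.submatrix (fun p => (p.1.1, (p.2, p.1.2))) id

lemma stinespring_absorbOutput [Fintype X] [Fintype S] [Fintype B]
    (K : Matrix (S × (A × B)) X ℂ) :
    stinespring (absorbOutput K) = partialTrace A B ∘ₗ stinespring K := by
  refine LinearMap.ext fun M => ?_
  ext a a'
  exact Fintype.sum_prod_type_right _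

lemma block_conjBy {Y C : Type*} [Fintype X] (V : Matrix (Y × C) X ℂ) (M : Matrix X X ℂ)
    (c c' : C) : block c c' (conjBy V M) =
      V.submatrix (fun y => (y, c)) id * M * (V.submatrix (fun y => (y, c')) id)ᴴ := rfl

lemma semilocal_kronecker_apply (V : Matrix (R × A) A' ℂ) (E : Superop (R × B) B)
    (ρ : Matrix A' A' ℂ) (σ : Matrix B B ℂ) (p q : A × B) :
    semilocal V E (ρ ⊗ₖ σ) p q = E (block p.1 q.1 (conjBy V ρ) ⊗ₖ σ) p.2 q.2 := by
  change E (block p.1 q.1 (relabel (shuffle R A B) (ampliate B (conjBy V) (ρ ⊗ₖ σ)))) _ _ = _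
  refine congrFun₂ (congrArg E ?_) _ _
  ext r r'
  rw [block_apply, relabel_apply, ampliate_apply, block_kronecker, map_smul]
  exact mul_comm _ _

variable [Fintype B]

lemma semilocal_apply [DecidableEq B] (V : Matrix (R × A) A' ℂ) (E : Superop (R × B) B)
    (M : Matrix (A' × B) (A' × B) ℂ) (p q : A × B) :
    semilocal V E M p q =
      E (block p.1 q.1 (conjBy (ampliateDilation B V) M)) p.2 q.2 := by
  rw [semilocal, ampliate_conjBy]
  rfl

lemma IsMinimalDilation.ampliateDilation [Fintype A] [DecidableEq R] [DecidableEq B]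
    {V : Matrix (R × A) A' ℂ} (hV : IsMinimalDilation V) :
    IsMinimalDilation (ampliateDilation B V) := by
  obtain ⟨P, hP⟩ := hV
  let e := Equiv.prodAssoc A A' B
  have hrows : environmentRows (QMix.ampliateDilation B V) =
      (environmentRows V ⊗ₖ (1 : Matrix B B ℂ)).submatrix id e.symm := rfl
  refine ⟨(P ⊗ₖ (1 : Matrix B B ℂ)).submatrix e.symm id, ?_⟩
  rw [hrows, Matrix.submatrix_mul_equiv, ← Matrix.mul_kronecker_mul, hP, Matrix.one_mul,
    Matrix.one_kronecker_one, Matrix.submatrix_id_id]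

variable [Fintype R]

lemma stinespring_ampliateDilation [DecidableEq B] (V : Matrix (R × A) A' ℂ) :
    stinespring (ampliateDilation B V) = stinespring V ∘ₗ partialTrace A' B := by
  refine LinearMap.ext fun M => ?_
  have htr : partialTrace A' B M = ∑ b, block b b M := by
    ext x x'
    simp [partialTrace, Matrix.sum_apply]
  ext a a'
  calc stinespring (ampliateDilation B V) M a a'
      = ∑ p : R × B, ampliate B (conjBy V) M ((p.1, a), p.2) ((p.1, a'), p.2) := by
        rw [ampliate_conjBy]
        rfl
    _ = ∑ b, stinespring V (block b b M) a a' := Fintype.sum_prod_type_right _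
    _ = stinespring V (partialTrace A' B M) a a' := by rw [htr, map_sum, Matrix.sum_apply]

lemma partialTrace_comp_semilocal (V : Matrix (R × A) A' ℂ) {E : Superop (R × B) B}
    (hE : IsTracePreserving E) :
    partialTrace A B ∘ₗ semilocal V E = stinespring V ∘ₗ partialTrace A' B := by
  classical
  rw [← stinespring_ampliateDilation]
  refine LinearMap.ext fun M => ?_
  ext a a'
  calc ∑ b, semilocal V E M (a, b) (a', b)
      = (E (block a a' (conjBy (ampliateDilation B V) M))).trace := by
        simp only [semilocal_apply, Matrix.trace, Matrix.diag_apply]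
    _ = stinespring (ampliateDilation B V) M a a' := hE _

lemma semilocal_stinespring [Fintype S] [DecidableEq B] {V : Matrix (R × A) A' ℂ}
    {U : Matrix (S × B) (R × B) ℂ} {K : Matrix (S × (A × B)) (A' × B) ℂ}
    (h : U * environmentRows (ampliateDilation B V) = environmentRows (absorbOutput K)) :
    semilocal V (stinespring U) = stinespring K := by
  have hslice : ∀ a, U * (ampliateDilation B V).submatrix (fun e => (e, a)) id =
      (absorbOutput K).submatrix (fun e => (e, a)) id := fun a => by
    ext e x
    exact congrFun₂ h e (a, x)
  refine LinearMap.ext fun M => ?_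
  ext ⟨a, b⟩ ⟨a', b'⟩
  let V' (c : A) := (ampliateDilation B V).submatrix (fun e => (e, c)) id
  have hconj : U * (V' a * M * (V' a')ᴴ) * Uᴴ = U * V' a * M * (U * V' a')ᴴ := by
    simp only [Matrix.conjTranspose_mul, Matrix.mul_assoc]
  rw [semilocal_apply, block_conjBy, stinespring_apply, hconj, hslice, hslice]
  rfl

theorem IsNonSignalling.exists_semilocal [DecidableEq A'] [Fintype A] [Nonempty B]
    {N : Superop (A' × B) (A × B)} (hns : IsNonSignalling N) (hN : IsChannel N) :
    ∃ (r : ℕ) (V : Matrix (Fin r × A) A' ℂ) (E : Superop (Fin r × B) B),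
      IsIsometry V ∧ IsChannel E ∧ IsMinimalDilation V ∧ N = semilocal V E := by
  classical
  obtain ⟨r, V, hV, hmin, hΦ⟩ := hN.reducedMap.exists_isMinimalDilation
  obtain ⟨k, K, -, -, rfl⟩ := hN.exists_isMinimalDilation
  have hdil : stinespring (absorbOutput K) = stinespring (ampliateDilation B V) := by
    rw [stinespring_absorbOutput, hns.partialTrace_comp, hΦ, stinespring_ampliateDilation]
  obtain ⟨U, hU, hUK⟩ := (hmin.ampliateDilation (B := B)).exists_isIsometry hdil
  exact ⟨r, V, stinespring U, hV, isChannel_stinespring hU, hmin,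
    (semilocal_stinespring hUK).symm⟩

end Semilocal

section Unital

variable {R A' A B : Type*} [Fintype A']

lemma IsMinimalDilation.exists_eq_sum_block [Finite R] [DecidableEq R] [Fintype A]
    {V : Matrix (R × A) A' ℂ} (hV : IsMinimalDilation V) (τ : Matrix R R ℂ) :
    ∃ X : A → A → Matrix A' A' ℂ, τ = ∑ a, ∑ a', block a a' (conjBy V (X a a')) := by
  cases nonempty_fintype R
  obtain ⟨P, hP⟩ := hV
  let Z : Matrix (A × A') (A × A') ℂ := P * τ * Pᴴ
  refine ⟨fun a a' => Z.submatrix (fun x => (a, x)) (fun x => (a', x)), ?_⟩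
  have hτ : τ = environmentRows V * Z * (environmentRows V)ᴴ := by
    calc τ = (environmentRows V * P) * τ * (environmentRows V * P)ᴴ := by
          rw [hP, Matrix.one_mul, Matrix.conjTranspose_one, Matrix.mul_one]
      _ = environmentRows V * Z * (environmentRows V)ᴴ := by
          simp only [Z, Matrix.conjTranspose_mul, Matrix.mul_assoc]
  conv_lhs => rw [hτ]
  ext r r'
  simp only [Matrix.sum_apply, block_apply, conjBy_apply, Matrix.mul_apply, environmentRows,
    Matrix.conjTranspose_apply, Matrix.of_apply, Matrix.submatrix_apply, Fintype.sum_prod_type,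
    Finset.sum_mul]
  rw [Finset.sum_comm (s := Finset.univ (α := A)) (t := Finset.univ (α := A))]
  exact Finset.sum_congr rfl fun a' _ => Finset.sum_comm

variable [Fintype R] [Fintype B] [DecidableEq B]

lemma semilocal_kronecker_unif (V : Matrix (R × A) A' ℂ) {E : Superop (R × B) B}
    (hE : IsChannel E) (hu : IsConditionallyUnitalPost E) (ρ : Matrix A' A' ℂ) :
    semilocal V E (ρ ⊗ₖ unif B) = stinespring V ρ ⊗ₖ unif B := by
  ext p q
  rw [semilocal_kronecker_apply, (isConditionallyUnitalPost_iff hE).mp hu]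
  rfl

variable [Fintype A]

lemma isConditionallyUnital_semilocal [DecidableEq A'] {V : Matrix (R × A) A' ℂ}
    {E : Superop (R × B) B} (hV : IsIsometry V) (hE : IsChannel E)
    (hu : IsConditionallyUnitalPost E) : IsConditionallyUnital (semilocal V E) := fun ρ hρ =>
  ⟨stinespring V ρ, (isChannel_stinespring hV).isState hρ, semilocal_kronecker_unif V hE hu ρ⟩

lemma IsConditionallyUnital.exists_apply_kronecker_unif {N : Superop (A' × B) (A × B)}
    (h : IsConditionallyUnital N) (ρ : Matrix A' A' ℂ) :
    ∃ σ : Matrix A A ℂ, N (ρ ⊗ₖ unif B) = σ ⊗ₖ unif B := by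
  have hle : Submodule.span ℂ {ρ : Matrix A' A' ℂ | IsState ρ} ≤
      (LinearMap.range (adjoinState A (unif B))).comap (N ∘ₗ adjoinState A' (unif B)) :=
    Submodule.span_le.mpr fun ρ hρ =>
      let ⟨σ, _, hσ⟩ := h ρ hρ
      ⟨σ, hσ.symm⟩
  obtain ⟨σ, hσ⟩ := hle (span_isState (X := A') ▸ Submodule.mem_top : ρ ∈ _)
  exact ⟨σ, hσ.symm⟩

theorem IsMinimalDilation.isConditionallyUnitalPost [DecidableEq R] [Nonempty B]
    {V : Matrix (R × A) A' ℂ} (hV : IsMinimalDilation V) {E : Superop (R × B) B}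
    (hE : IsChannel E) (h : IsConditionallyUnital (semilocal V E)) :
    IsConditionallyUnitalPost E := by
  have hblock : ∀ (a a' : A) (X : Matrix A' A' ℂ),
      E (block a a' (conjBy V X) ⊗ₖ unif B) ∈ Submodule.span ℂ {unif B} := by
    intro a a' X
    obtain ⟨σ, hσ⟩ := h.exists_apply_kronecker_unif X
    refine Submodule.mem_span_singleton.mpr ⟨σ a a', ?_⟩
    ext b b'
    simpa [semilocal_kronecker_apply] using (congrFun₂ hσ (a, b) (a', b')).symm
  refine (isConditionallyUnitalPost_iff hE).mpr fun τ => ?_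
  have hτ : E (τ ⊗ₖ unif B) ∈ Submodule.span ℂ {unif B} := by
    obtain ⟨X, rfl⟩ := hV.exists_eq_sum_block τ
    change (E ∘ₗ adjoinState R (unif B)) _ ∈ _
    simp only [map_sum]
    exact Submodule.sum_mem _ fun a _ => Submodule.sum_mem _ fun a' _ => hblock a a' _
  obtain ⟨c, hc⟩ := Submodule.mem_span_singleton.mp hτ
  have htr : c = τ.trace := by
    simpa [Matrix.trace_smul, hE.2 _, Matrix.trace_kronecker, isState_unif.2] using
      congrArg Matrix.trace hc
  rw [← hc, htr]

end Unital

section TracePreservation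

variable {X Y X' Y' C D : Type*}

lemma superAmpliate_apply [Fintype C] [DecidableEq C] (Θ : Supermap X Y X' Y')
    (F : Superop (X × C) (Y × D)) (M : Matrix (X' × C) (X' × C) ℂ) (p q : Y' × D) :
    superAmpliate Θ F M p q =
      ∑ c, ∑ c', Θ (component F c c' p.2 q.2) (block c c' M) p.1 q.1 := rfl

lemma component_apply [DecidableEq C] (F : Superop (X × C) (Y × D)) (c c' : C) (d d' : D)
    (M : Matrix X X ℂ) (y y' : Y) :
    component F c c' d d' M y y' = F (M ⊗ₖ Matrix.single c c' (1 : ℂ)) (y, d) (y', d') := rfl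

lemma component_ampliate [DecidableEq C] (F : Superop X Y) (c c' d d' : C) :
    component (ampliate C F) c c' d d' = (Matrix.single c c' (1 : ℂ) d d') • F := by
  refine LinearMap.ext fun M => ?_
  ext y y'
  rw [component_apply, ampliate_apply, block_kronecker, map_smul]
  rfl

lemma superAmpliate_ampliate [Fintype C] [DecidableEq C] (Θ : Supermap X Y X' Y')
    (F : Superop X Y) : superAmpliate Θ (ampliate C F) = ampliate C (Θ F) := by
  refine LinearMap.ext fun M => ?_
  ext p q
  simp only [superAmpliate_apply, component_ampliate, map_smul, LinearMap.smul_apply,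
    Matrix.smul_apply]
  simp [Matrix.single_apply, ite_and]

lemma component_relabel {C₀ D₀ : Type*} [DecidableEq C] [DecidableEq C₀] (eC : C ≃ C₀)
    (eD : D ≃ D₀) (F : Superop (X × C) (Y × D)) (c c' : C) (d d' : D) :
    component (relabel ((Equiv.refl Y).prodCongr eD) ∘ₗ F ∘ₗ
      relabel ((Equiv.refl X).prodCongr eC.symm)) (eC c) (eC c') (eD d) (eD d') =
      component F c c' d d' := by
  refine LinearMap.ext fun M => ?_
  have hM : relabel ((Equiv.refl X).prodCongr eC.symm)
      (M ⊗ₖ Matrix.single (eC c) (eC c') (1 : ℂ)) = M ⊗ₖ Matrix.single c c' (1 : ℂ) := by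
    ext p q
    simp [Matrix.single_apply]
  ext y y'
  simp [component_apply, hM]

lemma superAmpliate_eq_relabel {C₀ D₀ : Type*} [Fintype C] [DecidableEq C] [Fintype C₀]
    [DecidableEq C₀] (eC : C ≃ C₀) (eD : D ≃ D₀) (Θ : Supermap X Y X' Y')
    (F : Superop (X × C) (Y × D)) :
    superAmpliate Θ F = relabel ((Equiv.refl Y').prodCongr eD.symm) ∘ₗ
      superAmpliate Θ (relabel ((Equiv.refl Y).prodCongr eD) ∘ₗ F ∘ₗ
        relabel ((Equiv.refl X).prodCongr eC.symm)) ∘ₗ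
      relabel ((Equiv.refl X').prodCongr eC) := by
  refine LinearMap.ext fun M => ?_
  ext p q
  refine Fintype.sum_equiv eC _ _ fun c => Fintype.sum_equiv eC _ _ fun c' => ?_
  have hM : block c c' M = block (eC c) (eC c') (relabel ((Equiv.refl X').prodCongr eC) M) := by
    ext x x'
    simp
  rw [hM, ← component_relabel eC eD]
  rfl

/-- The conjugate `M ↦ F(M†)†` of a superoperator `F`; its Choi matrix is the adjoint of that
of `F`. -/
def conjugate (F : Superop X Y) : Superop X Y where
  toFun M := (F Mᴴ)ᴴ
  map_add' M N := by simp
  map_smul' c M := by simp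

lemma choi_conjugate [DecidableEq X] (F : Superop X Y) : choi (conjugate F) = (choi F)ᴴ := by
  ext p q
  simp [choi_apply, conjugate]

variable [Fintype X] [Fintype Y] [Fintype X'] [Fintype Y']

lemma IsSuperchannel.isChannel_superAmpliate [Fintype C] [DecidableEq C] [Fintype D]
    {Θ : Supermap X Y X' Y'} (hΘ : IsSuperchannel Θ) {F : Superop (X × C) (Y × D)}
    (hF : IsChannel F) : IsChannel (superAmpliate Θ F) := by
  rw [superAmpliate_eq_relabel (Fintype.equivFin C) (Fintype.equivFin D)]
  exact (isChannel_relabel _).comp ((hΘ _ _ _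
    ((isChannel_relabel _).comp (hF.comp (isChannel_relabel _)))).comp (isChannel_relabel _))

lemma IsSuperchannel.isTracePreserving {Θ : Supermap X Y X' Y'} (hΘ : IsSuperchannel Θ)
    {F : Superop X Y} (hF : IsChannel F) : IsTracePreserving (Θ F) := fun M => by
  have h := (hΘ.isChannel_superAmpliate (hF.ampliate (C := Unit))).2
    (M.submatrix Prod.fst Prod.fst)
  rw [superAmpliate_ampliate, trace_eq_sum_block, trace_eq_sum_block] at h
  have hM : block () () (M.submatrix Prod.fst Prod.fst) = M := rfl
  simpa [block_ampliate, hM] using h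

/-- The map `M ↦ tr M • u`, which discards its input and prepares the uniform state. -/
noncomputable def depolarize (X Y : Type*) [Fintype X] [Fintype Y] [DecidableEq Y] :
    Superop X Y :=
  (Matrix.traceLinearMap X ℂ ℂ).smulRight (unif Y)

lemma choi_depolarize [DecidableEq X] [DecidableEq Y] :
    choi (depolarize X Y) = (Fintype.card Y : ℂ)⁻¹ • (1 : Matrix (Y × X) (Y × X) ℂ) := by
  ext ⟨y, x⟩ ⟨y', x'⟩
  by_cases hx : x = x' <;> by_cases hy : y = y' <;>
    simp [choi_apply, depolarize, unif, hx, hy]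

-- The depolarizing map is in the interior of the completely positive maps, so a small multiple
-- of `F` can be added to it.
lemma exists_isChannel_depolarize_add_smul [DecidableEq X] [DecidableEq Y] [Nonempty Y]
    {F : Superop X Y} (hF : (choi F).IsHermitian) (htr : ∀ M, (F M).trace = 0) :
    ∃ c : ℂ, c ≠ 0 ∧ IsChannel (depolarize X Y + c • F) := by
  obtain ⟨c, hc, hpos⟩ := exists_one_add_smul_posSemidef hF
  have hn : (Fintype.card Y : ℂ) ≠ 0 := by exact_mod_cast Fintype.card_ne_zero
  refine ⟨(Fintype.card Y : ℂ)⁻¹ * c,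
    mul_ne_zero (inv_ne_zero hn) (by exact_mod_cast hc.ne'), ?_, fun M => ?_⟩
  · refine isCompletelyPositive_of_choi_posSemidef ?_
    rw [map_add, map_smul, choi_depolarize, mul_smul, ← smul_add]
    exact hpos.smul (inv_nonneg.mpr (Nat.cast_nonneg _))
  · simp [depolarize, Matrix.trace_add, Matrix.trace_smul, htr, isState_unif.2]

lemma isChannel_depolarize [DecidableEq Y] [Nonempty Y] : IsChannel (depolarize X Y) := by
  classical
  obtain ⟨c, -, h⟩ := exists_isChannel_depolarize_add_smul (X := X) (Y := Y) (F := 0)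
    (by simp) (by simp)
  simpa using h

lemma IsSuperchannel.trace_apply_eq_zero_of_isHermitian [DecidableEq X] [Nonempty Y]
    {Θ : Supermap X Y X' Y'} (hΘ : IsSuperchannel Θ) {F : Superop X Y}
    (hF : (choi F).IsHermitian) (htr : ∀ M, (F M).trace = 0) (M : Matrix X' X' ℂ) :
    (Θ F M).trace = 0 := by
  classical
  obtain ⟨c, hc, hcF⟩ := exists_isChannel_depolarize_add_smul hF htr
  have h := hΘ.isTracePreserving hcF M
  rw [map_add, map_smul, LinearMap.add_apply, Matrix.trace_add,
    hΘ.isTracePreserving isChannel_depolarize M, add_eq_left, LinearMap.smul_apply,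
    Matrix.trace_smul] at h
  exact (smul_eq_zero.mp h).resolve_left hc

theorem IsSuperchannel.trace_apply_eq_zero [Nonempty Y] {Θ : Supermap X Y X' Y'}
    (hΘ : IsSuperchannel Θ) {F : Superop X Y} (htr : ∀ M, (F M).trace = 0)
    (M : Matrix X' X' ℂ) : (Θ F M).trace = 0 := by
  classical
  let G := conjugate F
  have htrG : ∀ M, (G M).trace = 0 := fun M => by
    simp [G, conjugate, Matrix.trace_conjTranspose, htr]
  have hadd : (Θ (F + G) M).trace = 0 :=
    hΘ.trace_apply_eq_zero_of_isHermitian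
      (by
        rw [map_add, choi_conjugate]
        exact Matrix.isHermitian_add_transpose_self _)
      (fun M => by simp [Matrix.trace_add, htr, htrG]) M
  have hsub : (Θ (Complex.I • (F - G)) M).trace = 0 :=
    hΘ.trace_apply_eq_zero_of_isHermitian
      (by
        rw [map_smul, map_sub, choi_conjugate, Matrix.IsHermitian, Matrix.conjTranspose_smul]
        simp [add_comm, sub_eq_add_neg])
      (fun M => by simp [Matrix.trace_sub, htr, htrG]) M
  simp only [map_add, map_smul, map_sub, LinearMap.add_apply, LinearMap.sub_apply,
    LinearMap.smul_apply, Matrix.trace_add, Matrix.trace_sub, Matrix.trace_smul, smul_eq_mul,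
    mul_eq_zero, Complex.I_ne_zero, false_or] at hadd hsub
  linear_combination (hadd + hsub) / 2

end TracePreservation
section PrePost

variable {R A' A B C D : Type*}

/-- The supermap `F ↦ E ∘ (id ⊗ F) ∘ V`, that is, `prePost` as a linear map. -/
def prePostSupermap [Fintype A'] (V : Matrix (R × A) A' ℂ) (E : Superop (R × B) B) :
    Supermap A B A' B where
  toFun := prePost V E
  map_add' F G := by
    have hadd : ampliate R (F + G) = ampliate R F + ampliate R G := rfl
    simp only [prePost, hadd, LinearMap.comp_add, LinearMap.add_comp]
  map_smul' a F := by
    have hsmul : ampliate R (a • F) = a • ampliate R F := rfl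
    simp only [prePost, hsmul, LinearMap.comp_smul, LinearMap.smul_comp, RingHom.id_apply]

lemma superAmpliate_prePostSupermap [Fintype A'] [Fintype C] [DecidableEq C]
    (V : Matrix (R × A) A' ℂ) (E : Superop (R × B) B) (F : Superop (A × C) (B × D)) :
    superAmpliate (prePostSupermap V E) F =
      ampliate D E ∘ₗ relabel ((Equiv.prodComm (B × D) R).trans (Equiv.prodAssoc R B D).symm) ∘ₗ
        ampliate R F ∘ₗ relabel ((Equiv.prodAssoc R A C).trans (Equiv.prodComm R (A × C))) ∘ₗ
        ampliate C (conjBy V) := by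
  refine LinearMap.ext fun M => ?_
  ext ⟨b, d⟩ ⟨b', d'⟩
  let G : Matrix (R × B) (R × B) ℂ := ∑ c, ∑ c',
    relabel (Equiv.prodComm B R) (ampliate R (component F c c' d d')
      (relabel (Equiv.prodComm R A) (conjBy V (block c c' M))))
  let e₁ := (Equiv.prodAssoc R A C).trans (Equiv.prodComm R (A × C))
  let e₂ := (Equiv.prodComm (B × D) R).trans (Equiv.prodAssoc R B D).symm
  have hG : G = block d d' (relabel e₂ (ampliate R F (relabel e₁ (ampliate C (conjBy V) M)))) := by
    ext ⟨r, x⟩ ⟨r', x'⟩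
    rw [block_apply, relabel_apply, ampliate_apply]
    conv_rhs => rw [eq_sum_block_kronecker (block _ _ _)]
    simp only [G, Matrix.sum_apply, map_sum]
    rfl
  have hE : superAmpliate (prePostSupermap V E) F M (b, d) (b', d') = E G b b' := by
    simp only [G, map_sum, Matrix.sum_apply]
    rfl
  rw [hE, hG]
  rfl

/-- The bipartite map `A'B → AB` of a supermap, obtained by applying it to the swap
`AB → BA`; this is the map `𝐟` of the theorem. -/
def toBipartite [Fintype B] [DecidableEq B] (Θ : Supermap A B A' B) :
    Superop (A' × B) (A × B) :=
  relabel (Equiv.prodComm B A) ∘ₗ superAmpliate Θ (relabel (Equiv.prodComm A B))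

lemma toBipartite_prePostSupermap [Fintype A'] [Fintype B] [DecidableEq B]
    (V : Matrix (R × A) A' ℂ) (E : Superop (R × B) B) :
    toBipartite (prePostSupermap V E) = semilocal V E := by
  rw [toBipartite, superAmpliate_prePostSupermap]
  rfl

/-- The map `M ↦ M a a' • σ`, which reads off an entry of its input and prepares `σ`. -/
def entryPrepare (a a' : A) (σ : Matrix B B ℂ) : Superop A B :=
  (Matrix.entryLinearMap ℂ ℂ a a').smulRight σ

lemma entryPrepare_apply (a a' : A) (σ : Matrix B B ℂ) (M : Matrix A A ℂ) :
    entryPrepare a a' σ M = M a a' • σ := rfl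

lemma component_swap [DecidableEq B] (b b' : B) (a a' : A) :
    component (relabel (Equiv.prodComm A B)) b b' a a' =
      entryPrepare a a' (Matrix.single b b' (1 : ℂ)) := rfl

lemma eq_sum_entryPrepare [Fintype A] [DecidableEq A] (F : Superop A B) :
    F = ∑ a, ∑ a', entryPrepare a a' (F (Matrix.single a a' 1)) := by
  refine LinearMap.ext fun M => ?_
  conv_lhs => rw [Matrix.matrix_eq_sum_single M]
  simp only [map_sum, LinearMap.sum_apply, entryPrepare_apply]
  refine Finset.sum_congr rfl fun a _ => Finset.sum_congr rfl fun a' _ => ?_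
  rw [← map_smul, Matrix.smul_single, smul_eq_mul, mul_one]

lemma toBipartite_kronecker [Fintype B] [DecidableEq B] (Θ : Supermap A B A' B)
    (ρ : Matrix A' A' ℂ) (σ : Matrix B B ℂ) (a a' : A) (b b' : B) :
    toBipartite Θ (ρ ⊗ₖ σ) (a, b) (a', b') = Θ (entryPrepare a a' σ) ρ b b' := by
  have hσ : entryPrepare a a' σ =
      ∑ c, ∑ c', σ c c' • entryPrepare a a' (Matrix.single c c' (1 : ℂ)) := by
    refine LinearMap.ext fun M => ?_
    conv_lhs => rw [entryPrepare_apply, Matrix.matrix_eq_sum_single σ]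
    simp only [LinearMap.sum_apply, LinearMap.smul_apply, entryPrepare_apply, Finset.smul_sum,
      Matrix.smul_single, smul_eq_mul, mul_one, mul_comm]
  rw [hσ]
  simp [toBipartite, superAmpliate_apply, component_swap, block_kronecker, Matrix.sum_apply]

lemma toBipartite_injective [Finite A] [Fintype B] [DecidableEq B] :
    Function.Injective (toBipartite : Supermap A B A' B → Superop (A' × B) (A × B)) := by
  classical
  cases nonempty_fintype A
  intro Θ Θ' h
  refine LinearMap.ext fun F => LinearMap.ext fun ρ => ?_
  ext b b'
  rw [eq_sum_entryPrepare F]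
  simp only [map_sum, LinearMap.sum_apply, Matrix.sum_apply, ← toBipartite_kronecker, h]

lemma IsSuperchannel.isChannel_toBipartite [Fintype A'] [Fintype A] [Fintype B] [DecidableEq B]
    {Θ : Supermap A B A' B} (hΘ : IsSuperchannel Θ) : IsChannel (toBipartite Θ) :=
  (isChannel_relabel _).comp (hΘ.isChannel_superAmpliate (isChannel_relabel _))

variable [Fintype R] [Fintype A'] [DecidableEq A'] [Fintype A] [Fintype B]

lemma isChannel_semilocal {V : Matrix (R × A) A' ℂ} {E : Superop (R × B) B}
    (hV : IsIsometry V) (hE : IsChannel E) : IsChannel (semilocal V E) :=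
  (isChannel_relabel _).comp (hE.ampliate.comp ((isChannel_relabel _).comp
    (isChannel_conjBy hV).ampliate))

lemma isSuperchannel_prePostSupermap {V : Matrix (R × A) A' ℂ} {E : Superop (R × B) B}
    (hV : IsIsometry V) (hE : IsChannel E) : IsSuperchannel (prePostSupermap V E) := by
  intro k l F hF
  rw [superAmpliate_prePostSupermap]
  exact hE.ampliate.comp ((isChannel_relabel _).comp (hF.ampliate.comp
    ((isChannel_relabel _).comp (isChannel_conjBy hV).ampliate)))

lemma isRealization_iff {Θ : Supermap A B A' B} {V : Matrix (R × A) A' ℂ}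
    {E : Superop (R × B) B} :
    IsRealization Θ V E ↔ IsIsometry V ∧ IsChannel E ∧ Θ = prePostSupermap V E :=
  and_congr_right fun _ => and_congr_right fun _ =>
    (LinearMap.ext_iff (f := Θ) (g := prePostSupermap V E)).symm

lemma IsRealization.isSuperchannel {Θ : Supermap A B A' B} {V : Matrix (R × A) A' ℂ}
    {E : Superop (R × B) B} (h : IsRealization Θ V E) : IsSuperchannel Θ := by
  obtain ⟨hV, hE, rfl⟩ := isRealization_iff.mp h
  exact isSuperchannel_prePostSupermap hV hE

lemma IsRealization.toBipartite_eq [DecidableEq B] {Θ : Supermap A B A' B}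
    {V : Matrix (R × A) A' ℂ} {E : Superop (R × B) B} (h : IsRealization Θ V E) :
    toBipartite Θ = semilocal V E := by
  obtain ⟨_, _, rfl⟩ := isRealization_iff.mp h
  exact toBipartite_prePostSupermap V E

end PrePost

section Bijection

variable {R A' A B : Type*} [Fintype B]

lemma traceSnd_toBipartite_kronecker [DecidableEq B] (Θ : Supermap A B A' B) (ρ : Matrix A' A' ℂ)
    (σ : Matrix B B ℂ) (a a' : A) :
    traceSnd (toBipartite Θ (ρ ⊗ₖ σ)) a a' = (Θ (entryPrepare a a' σ) ρ).trace := by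
  simp [traceSnd_apply, Matrix.trace, toBipartite_kronecker]

variable [Fintype A']

lemma isNonSignalling_semilocal [Fintype R] (V : Matrix (R × A) A' ℂ) {E : Superop (R × B) B}
    (hE : IsTracePreserving E) : IsNonSignalling (semilocal V E) :=
  isNonSignalling_of_partialTrace_comp (partialTrace_comp_semilocal V hE)

lemma stinespring_eq_of_semilocal_eq {S : Type*} [Fintype R] [Fintype S] [Nonempty B]
    {V : Matrix (R × A) A' ℂ} {E : Superop (R × B) B} {W : Matrix (S × A) A' ℂ}
    {F : Superop (S × B) B} (hE : IsTracePreserving E) (hF : IsTracePreserving F)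
    (h : semilocal W F = semilocal V E) : stinespring W = stinespring V := by
  classical
  have hcomp : stinespring W ∘ₗ partialTrace A' B = stinespring V ∘ₗ partialTrace A' B := by
    rw [← partialTrace_comp_semilocal W hF, h, partialTrace_comp_semilocal V hE]
  have hsurj : Function.Surjective (partialTrace A' B) := fun ρ =>
    ⟨ρ ⊗ₖ unif B, isState_unif.traceSnd_kronecker ρ⟩
  exact (LinearMap.cancel_right hsurj).mp hcomp

variable [Fintype A]

lemma IsSuperchannel.isNonSignalling_toBipartite [DecidableEq B] [Nonempty B]
    {Θ : Supermap A B A' B} (hΘ : IsSuperchannel Θ) : IsNonSignalling (toBipartite Θ) := by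
  classical
  refine isNonSignalling_of_partialTrace_comp (partialTrace_comp_of_kronecker
    fun ρ σ _ hσ => ?_)
  ext a a'
  have hsub : entryPrepare a a' σ - entryPrepare a a' (unif B) =
      entryPrepare a a' (σ - unif B) := by
    refine LinearMap.ext fun M => ?_
    simp [entryPrepare_apply, smul_sub]
  have htr : ∀ M, (entryPrepare a a' (σ - unif B) M).trace = 0 := fun M => by
    rw [entryPrepare_apply, Matrix.trace_smul, Matrix.trace_sub, hσ.2, isState_unif.2, sub_self,
      smul_zero]
  have h := hΘ.trace_apply_eq_zero htr ρ
  rw [← hsub, map_sub, LinearMap.sub_apply, Matrix.trace_sub, sub_eq_zero] at h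
  rw [traceSnd_toBipartite_kronecker, traceSnd_toBipartite_kronecker, h]

theorem IsSuperchannel.exists_realization [DecidableEq A'] [Nonempty B]
    {Θ : Supermap A B A' B} (hΘ : IsSuperchannel Θ) :
    ∃ (r : ℕ) (V : Matrix (Fin r × A) A' ℂ) (E : Superop (Fin r × B) B),
      IsRealization Θ V E := by
  classical
  obtain ⟨r, V, E, hV, hE, -, h⟩ :=
    hΘ.isNonSignalling_toBipartite.exists_semilocal hΘ.isChannel_toBipartite
  rw [← toBipartite_prePostSupermap] at h
  exact ⟨r, V, E, isRealization_iff.mpr ⟨hV, hE, toBipartite_injective h⟩⟩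

theorem IsMinimalDilation.isStandardForm [DecidableEq A'] [Nonempty B] {r : ℕ}
    {V : Matrix (Fin r × A) A' ℂ} (hmin : IsMinimalDilation V) {E : Superop (Fin r × B) B}
    {Θ : Supermap A B A' B} (h : IsRealization Θ V E) : IsStandardForm Θ r V E := by
  classical
  refine ⟨h, fun s W F h' => ?_⟩
  obtain ⟨U, hU, -⟩ := hmin.exists_isIsometry (stinespring_eq_of_semilocal_eq h.2.1.2 h'.2.1.2
    (h'.toBipartite_eq.symm.trans h.toBipartite_eq))
  simpa using hU.card_le

lemma isConditionallyMixing_semilocal [DecidableEq A'] [DecidableEq B] [Fintype R]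
    {V : Matrix (R × A) A' ℂ} {E : Superop (R × B) B} (hV : IsIsometry V) (hE : IsChannel E)
    (hu : IsConditionallyUnitalPost E) : IsConditionallyMixing (semilocal V E) :=
  ⟨isChannel_semilocal hV hE, isNonSignalling_semilocal V hE.2,
    isConditionallyUnital_semilocal hV hE hu⟩

theorem IsConditionallyMixing.exists_isStandardForm [DecidableEq A'] [DecidableEq B] [Nonempty B]
    {N : Superop (A' × B) (A × B)} (h : IsConditionallyMixing N) :
    ∃ (Θ : Supermap A B A' B) (r : ℕ) (V : Matrix (Fin r × A) A' ℂ) (E : Superop (Fin r × B) B),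
      IsStandardForm Θ r V E ∧ IsConditionallyUnitalPost E ∧ N = semilocal V E := by
  obtain ⟨hN, hns, hu⟩ := h
  obtain ⟨r, V, E, hV, hE, hmin, rfl⟩ := hns.exists_semilocal hN
  exact ⟨prePostSupermap V E, r, V, E, hmin.isStandardForm (isRealization_iff.mpr ⟨hV, hE, rfl⟩),
    hmin.isConditionallyUnitalPost hE hu, rfl⟩

end Bijection

end QMix

theorem theorem14 {A' A B : Type*}
    [Fintype A'] [DecidableEq A'] [Nonempty A'] [Fintype A] [DecidableEq A] [Nonempty A]
    [Fintype B] [DecidableEq B] [Nonempty B] :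
    (∀ N : QMix.Superop (A' × B) (A × B), QMix.IsChannel N →
      (QMix.IsNonSignalling N ↔
        ∃ (r : ℕ) (V : Matrix (Fin r × A) A' ℂ) (E : QMix.Superop (Fin r × B) B),
          QMix.IsIsometry V ∧ QMix.IsChannel E ∧ N = QMix.semilocal V E)) ∧
    (∀ N : QMix.Superop (A' × B) (A × B), QMix.IsChannel N →
      (QMix.IsConditionallyMixing N ↔
        ∃ (r : ℕ) (V : Matrix (Fin r × A) A' ℂ) (E : QMix.Superop (Fin r × B) B),
          QMix.IsIsometry V ∧ QMix.IsChannel E ∧ QMix.IsConditionallyUnitalPost E ∧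
            N = QMix.semilocal V E)) ∧
    (∀ Θ : QMix.Supermap A B A' B, QMix.IsSuperchannel Θ →
      ∃ (r : ℕ) (V : Matrix (Fin r × A) A' ℂ) (E : QMix.Superop (Fin r × B) B),
        QMix.IsRealization Θ V E) ∧
    (∃ f : QMix.Supermap A B A' B → QMix.Superop (A' × B) (A × B),
      (∀ (Θ : QMix.Supermap A B A' B) (r : ℕ) (V : Matrix (Fin r × A) A' ℂ)
          (E : QMix.Superop (Fin r × B) B),
        QMix.IsRealization Θ V E → f Θ = QMix.semilocal V E) ∧
      Set.BijOn f {Θ | QMix.IsSuperchannel Θ}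
        {N | QMix.IsChannel N ∧ QMix.IsNonSignalling N} ∧
      Set.BijOn f {Θ | QMix.IsMixing Θ} {N | QMix.IsConditionallyMixing N}) := by
  refine ⟨fun N hN => ⟨fun h => ?_, ?_⟩, fun N _ => ⟨fun h => ?_, ?_⟩,
    fun Θ hΘ => hΘ.exists_realization, QMix.toBipartite, fun Θ r V E h => h.toBipartite_eq,
    ⟨fun Θ hΘ => ⟨hΘ.isChannel_toBipartite, hΘ.isNonSignalling_toBipartite⟩,
      QMix.toBipartite_injective.injOn, ?_⟩,
    ⟨?_, QMix.toBipartite_injective.injOn, fun N hN => ?_⟩⟩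
  · obtain ⟨r, V, E, hV, hE, -, hNVE⟩ := h.exists_semilocal hN
    exact ⟨r, V, E, hV, hE, hNVE⟩
  · rintro ⟨r, V, E, -, hE, rfl⟩
    exact QMix.isNonSignalling_semilocal V hE.2
  · obtain ⟨_, r, V, E, hst, hu, hNVE⟩ := h.exists_isStandardForm
    exact ⟨r, V, E, hst.1.1, hst.1.2.1, hu, hNVE⟩
  · rintro ⟨r, V, E, hV, hE, hu, rfl⟩
    exact QMix.isConditionallyMixing_semilocal hV hE hu
  · rintro N ⟨hN, hns⟩
    obtain ⟨r, V, E, hV, hE, -, rfl⟩ := hns.exists_semilocal hN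
    exact ⟨_, QMix.isSuperchannel_prePostSupermap hV hE, QMix.toBipartite_prePostSupermap V E⟩
  · rintro Θ ⟨-, r, V, E, hst, hu⟩
    exact hst.1.toBipartite_eq ▸ QMix.isConditionallyMixing_semilocal hst.1.1 hst.1.2.1 hu
  · obtain ⟨Θ, r, V, E, hst, hu, rfl⟩ := hN.exists_isStandardForm
    exact ⟨Θ, ⟨hst.1.isSuperchannel, r, V, E, hst, hu⟩, hst.1.toBipartite_eq⟩
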